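/- Let $A$ be a finite set with $q = |A| \ge 2$, and let $m \ge n \ge 2$. Write $\mathrm{Tran}(A^n)$ for the set of all maps $A^n \to A^n$, and $\mathrm{pr}_{[n]} : A^m \to A^n$ for the projection to the first $n$ coordinates. Maps are written on the right and composed from left to right. For $f : A^m \to A^m$ with coordinate functions $f_1,\dots,f_m$, let $F^{(i)} : A^m \to A^m$ be the instruction $x_i \gets (x)f_i$, which replaces the $i$-th coordinate of $x$ by $(x)f_i$ and keeps the others, and let $S_f = \langle F^{(1)},\dots,F^{(m)}\rangle$ be the semigroup generated by these instructions. The memoryless complexity of $h \in S_f$ is the minimum length of a sequence of instructions $F^{(i)}$ whose composition is $h$ (the empty sequence, of length $0$, composing to the identity). The map $f$ sequentially simulates $g^{(1)},\dots,g^{(\ell)} \in \mathrm{Tran}(A^n)$ via $h^{(1)},\dots,h^{(\ell)} \in S_f$ if $$\mathrm{pr}_{[n]} \circ g^{(i)} = h^{(1)} \circ \cdots \circ h^{(i)} \circ \mathrm{pr}_{[n]} \qquad (1 \le i \le \ell),$$ and $f$ is complete $n$-universal if every finite sequence in $\mathrm{Tran}(A^n)$ is sequentially simulated by $f$ via some such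 $h^{(1)},\dots,h^{(\ell)}$. The sequential time $\mathrm{st}_f(g^{(1)},\dots,g^{(\ell)})$ is the minimum total number of updates of such a simulation, that is, the minimum over all admissible $h^{(1)},\dots,h^{(\ell)}$ of the sum of their memoryless complexities, and $$\mathbf{st}^{\min}_f = \min\left\{ \mathrm{st}_f(g^{(1)},\dots,g^{(q^{nq^n})}) : g^{(i)} \in \mathrm{Tran}(A^n),\ g^{(i)} \ne g^{(j)} \text{ for } i \ne j \right\}.$$ **Theorem.** (1) Every complete $n$-universal transformation $f : A^m \to A^m$ (with any $m \ge n \ge 2$) satisfies $q^{nq^n} \le \mathbf{st}^{\min}_f$. (2) Conversely, for every finite set $A$ with $q = |A| \ge 2$ and every $n \ge 2$ there are $m \ge n$ and a complete $n$-universal transformation $f : A^m \to A^m$ such that $$\mathbf{st}^{\min}_f = (1+o(1))\, q^{nq^n},$$ where the $o(1)$ term is bounded in absolute value by a quantity that depends only on $n$ and tends to $0$ as $n \to \infty$. -/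

import Mathlib

namespace UniversalSimulation

/-- The transformations of `A^n`; the registers `1, …, n` are indexed by `Fin n`. -/
abbrev Tran (A : Type*) (n : ℕ) : Type _ := (Fin n → A) → (Fin n → A)

/-- The projection `A^m → A^n` to the first `n` registers. -/
def proj {A : Type*} {n m : ℕ} (hnm : n ≤ m) (x : Fin m → A) : Fin n → A :=
  fun i => x (Fin.castLE hnm i)

/-- The composite of a list of self-maps, the head of the list being applied first
(composition of maps acting on the right). The composite of the empty list is the identity. -/
def composite {X : Type*} (l : List (X → X)) : X → X :=
  fun x => l.foldl (fun y t => t y) x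

/-- The instruction `F^(i) : x_i ← f_i(x)` induced by the `i`-th coordinate function of `f`:
register `i` is updated, all the other registers are kept. -/
def instruction {A : Type*} {m : ℕ} (f : Tran A m) (i : Fin m) : Tran A m :=
  fun x => Function.update x i (f x i)

/-- The semigroup `S_f` of transformations of `A^m` generated by the instructions induced by
the coordinate functions of `f`. (As a set, it does not depend on the side on which maps are
written.) -/
def instructionSemigroup {A : Type*} {m : ℕ} (f : Tran A m) :
    Subsemigroup (Function.End (Fin m → A)) :=
  Subsemigroup.closure (Set.range (instruction f : Fin m → Function.End (Fin m → A)))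

/-- The memoryless complexity of `h` with respect to the instructions of `f`: the minimum
length of a program `F^(w_1), …, F^(w_k)` whose composite is `h` (meaningful for `h ∈ S_f`). -/
noncomputable def complexity {A : Type*} {m : ℕ} (f h : Tran A m) : ℕ :=
  sInf {k : ℕ | ∃ w : List (Fin m), w.length = k ∧ composite (w.map (instruction f)) = h}

/-- `h^(1), …, h^(ℓ) ∈ S_f` sequentially simulate `g^(1), …, g^(ℓ)`: for every `i`, applying
`h^(1), …, h^(i)` in this order and then projecting to the first `n` registers is the same as
projecting and then applying `g^(i)`. -/
def SimulatesVia {A : Type*} {n m : ℕ} (hnm : n ≤ m) (f : Tran A m) {l : ℕ}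
    (g : Fin l → Tran A n) (h : Fin l → Tran A m) : Prop :=
  (∀ i, h i ∈ instructionSemigroup f) ∧
    ∀ (i : Fin l) (x : Fin m → A),
      proj hnm (composite ((List.ofFn h).take (i + 1)) x) = g i (proj hnm x)

/-- `f` sequentially simulates the sequence `g^(1), …, g^(ℓ)`. -/
def SequentiallySimulates {A : Type*} {n m : ℕ} (hnm : n ≤ m) (f : Tran A m) {l : ℕ}
    (g : Fin l → Tran A n) : Prop :=
  ∃ h : Fin l → Tran A m, SimulatesVia hnm f g h

/-- `f` is complete `n`-universal: it sequentially simulates every finite sequence of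
transformations of `A^n`. -/
def IsCompleteUniversal {A : Type*} {n m : ℕ} (hnm : n ≤ m) (f : Tran A m) : Prop :=
  ∀ (l : ℕ) (g : Fin l → Tran A n), SequentiallySimulates hnm f g

/-- The sequential time of simulation `st_f(g^(1), …, g^(ℓ))`: the minimum total number of
updates of a program that runs through `h^(1), …, h^(ℓ)` in turn, over all choices of
`h^(1), …, h^(ℓ) ∈ S_f` that sequentially simulate `g^(1), …, g^(ℓ)`
(meaningful if `f` sequentially simulates this sequence). -/
noncomputable def seqTime {A : Type*} {n m : ℕ} (hnm : n ≤ m) (f : Tran A m) {l : ℕ}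
    (g : Fin l → Tran A n) : ℕ :=
  sInf {t : ℕ | ∃ h : Fin l → Tran A m, SimulatesVia hnm f g h ∧ t = ∑ i, complexity f (h i)}

/-- The minimal sequential time `st^min_f`: the minimum of `st_f(g^(1), …, g^(N))` over the
sequences of `N = q^(n q^n)` pairwise distinct transformations of `A^n`, where `q = |A|`. -/
noncomputable def minSeqTime {A : Type*} [Fintype A] {n m : ℕ} (hnm : n ≤ m)
    (f : Tran A m) : ℕ :=
  sInf {t : ℕ | ∃ g : Fin (Fintype.card A ^ (n * Fintype.card A ^ n)) → Tran A n,
    Function.Injective g ∧ t = seqTime hnm f g}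

end UniversalSimulation

/-!
The lower bound is a count. In a simulation of all the transformations of `A^n`, consecutive
transformations differ, so every one but the first takes an update. The first one may be free
(if it is the identity), but if every other one took a single update, then only the first `n`
registers would ever be updated, and the network obtained by freezing the remaining registers
would generate all of `Tran(A^n)` with one instruction per register. This is impossible
(`exists_ne_run`): some instruction is not injective, hence useless for permutations.

For the upper bound let `A` be a cyclic group of order `q` with generator `u`, and take `3n`
registers `x`, `z`, `t` with the rules `x_i ← x_i + u` if `t = z` (and `x_i ← x_i` otherwise),
`z_i ← z_i + u`, `t_i ← z_i + x_i`. Updating every `t_i` once stores the input `v` as the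
difference `t - z`, whatever the initial content of `z` and `t`. From then on `t - z = v - k`,
where the "pointer" `k` is known and can be moved by updating `z`; an update of `x_i` adds
`u e_i` to the value of the simulated transformation at the input `k`, and changes it nowhere
else (`Tracks`). These steps generate `Tran(A^n)`, which is a group under pointwise addition, so
the network is complete universal.

A modular Gray code visits all of `Tran(A^n)` by such steps (`exists_prefix_gray_sum_eq`). If the
`n` steps at the input `0` are the fastest digits of the code, then only one step in about `q^n`
has to move the pointer away from `0` and back, which takes at most `2 n q` updates
(`sum_map_gray_append_le`). The overhead relative to the number of transformations is therefore
at most `2 n q / q^n` plus the negligible initialization, which is at most `5 n / 2^n`.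
-/

namespace UniversalSimulation

section Composite

variable {X : Type*}

@[simp] theorem composite_nil : composite ([] : List (X → X)) = id := rfl

@[simp] theorem composite_cons (t : X → X) (l : List (X → X)) :
    composite (t :: l) = composite l ∘ t := rfl

theorem composite_append (l₁ l₂ : List (X → X)) :
    composite (l₁ ++ l₂) = composite l₂ ∘ composite l₁ := by
  induction l₁ with
  | nil => rfl
  | cons t l ih => simp [ih, Function.comp_assoc]

theorem composite_take_succ {l : ℕ} (h : Fin l → X → X) (i : ℕ) (hi : i < l) :
    composite ((List.ofFn h).take (i + 1)) = h ⟨i, hi⟩ ∘ composite ((List.ofFn h).take i) := by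
  rw [List.take_succ_eq_append_getElem (by simpa using hi), composite_append]
  simp

theorem composite_injective {l : List (X → X)} (hl : ∀ t ∈ l, Function.Injective t) :
    Function.Injective (composite l) := by
  induction l with
  | nil => exact Function.injective_id
  | cons t l ih =>
    rw [composite_cons]
    exact (ih fun s hs => hl s (List.mem_cons_of_mem _ hs)).comp (hl t List.mem_cons_self)

theorem injective_of_composite_injective [Finite X] {l : List (X → X)}
    (hl : Function.Injective (composite l)) : ∀ t ∈ l, Function.Injective t := by
  induction l with
  | nil => simp
  | cons t l ih =>
    rw [composite_cons] at hl
    have ht : Function.Injective t := hl.of_comp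
    have hl' := hl.of_comp_right (Finite.surjective_of_injective ht)
    intro s hs
    rcases List.mem_cons.1 hs with rfl | hs
    · exact ht
    · exact ih hl' s hs

end Composite

section Programs

variable {A : Type*} {m : ℕ}

/-- The transformation computed by the program `w`, a list of registers to be updated. -/
def run (f : Tran A m) (w : List (Fin m)) : Tran A m :=
  composite (w.map (instruction f))

@[simp] theorem run_nil (f : Tran A m) : run f [] = id := rfl

theorem run_singleton (f : Tran A m) (i : Fin m) : run f [i] = instruction f i := rfl

theorem run_cons (f : Tran A m) (i : Fin m) (w : List (Fin m)) :
    run f (i :: w) = run f w ∘ instruction f i := rfl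

theorem run_append (f : Tran A m) (w₁ w₂ : List (Fin m)) :
    run f (w₁ ++ w₂) = run f w₂ ∘ run f w₁ := by
  simp [run, composite_append]

theorem run_mem_instructionSemigroup (f : Tran A m) {w : List (Fin m)} (hw : w ≠ []) :
    run f w ∈ instructionSemigroup f := by
  induction w with
  | nil => exact absurd rfl hw
  | cons i w ih =>
    have hi : instruction f i ∈ instructionSemigroup f :=
      Subsemigroup.subset_closure ⟨i, rfl⟩
    rcases eq_or_ne w [] with rfl | hne
    · exact hi
    · exact Subsemigroup.mul_mem (instructionSemigroup f) (ih hne) hi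

theorem exists_run_eq {f h : Tran A m} (hh : h ∈ instructionSemigroup f) :
    ∃ w, run f w = h := by
  refine Subsemigroup.closure_induction (p := fun (h : Function.End (Fin m → A)) _ => ∃ w, run f w = h) ?_ ?_ hh
  · rintro _ ⟨i, rfl⟩
    exact ⟨[i], rfl⟩
  · rintro _ _ _ _ ⟨w₁, rfl⟩ ⟨w₂, rfl⟩
    exact ⟨w₂ ++ w₁, run_append f w₂ w₁⟩

theorem complexity_run_le (f : Tran A m) (w : List (Fin m)) :
    complexity f (run f w) ≤ w.length :=
  Nat.sInf_le ⟨w, rfl, rfl⟩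

theorem exists_run_eq_of_length_eq_complexity {f h : Tran A m}
    (hh : h ∈ instructionSemigroup f) :
    ∃ w : List (Fin m), w.length = complexity f h ∧ run f w = h := by
  obtain ⟨w, hw⟩ := exists_run_eq hh
  exact Nat.sInf_mem (s := {k : ℕ | ∃ w : List (Fin m), w.length = k ∧
    composite (w.map (instruction f)) = h}) ⟨_, w, rfl, hw⟩

theorem SimulatesVia.seqTime_le {n l : ℕ} {hnm : n ≤ m} {f : Tran A m} {g : Fin l → Tran A n}
    {h : Fin l → Tran A m} (hsim : SimulatesVia hnm f g h) :
    seqTime hnm f g ≤ ∑ i, complexity f (h i) :=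
  Nat.sInf_le ⟨h, hsim, rfl⟩

theorem minSeqTime_le_seqTime [Fintype A] {n : ℕ} {hnm : n ≤ m} {f : Tran A m}
    {g : Fin (Fintype.card A ^ (n * Fintype.card A ^ n)) → Tran A n}
    (hg : Function.Injective g) : minSeqTime hnm f ≤ seqTime hnm f g :=
  Nat.sInf_le ⟨g, hg, rfl⟩

end Programs

/-! ### The lower bound -/

/-- The instructions of a transformation of `A^n` itself never generate all of `Tran(A^n)`:
a constant map needs an instruction `F^(j)` that is not injective, a permutation cannot use
`F^(j)`, and so no generated permutation changes register `j`. -/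
theorem exists_ne_run {A : Type*} [Finite A] [Nontrivial A] {n : ℕ} (hn : 0 < n)
    (f : Tran A n) : ∃ g : Tran A n, ∀ w, run f w ≠ g := by
  by_contra! hall
  obtain ⟨a, b, hab⟩ := exists_pair_ne A
  have : ∃ j, ¬ Function.Injective (instruction f j) := by
    by_contra! hinj
    obtain ⟨w, hw⟩ := hall fun _ _ => a
    have hc : Function.Injective (run f w) := composite_injective fun t ht => by
      obtain ⟨i, -, rfl⟩ := List.mem_map.1 ht
      exact hinj i
    rw [hw] at hc
    have := congrFun (@hc (fun _ => a) (fun _ => b) rfl) ⟨0, hn⟩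
    exact hab this
  obtain ⟨j, hj⟩ := this
  classical
  obtain ⟨w, hw⟩ := hall fun v => Function.update v j (Equiv.swap a b (v j))
  have hinj : Function.Injective (run f w) := by
    rw [hw]
    intro v v' hv
    ext i
    have hi := congrFun hv i
    by_cases hij : i = j
    · subst hij; simpa using hi
    · simpa [hij] using hi
  have hjw : j ∉ w := fun hmem =>
    hj (injective_of_composite_injective hinj _ (List.mem_map_of_mem hmem))
  have hkeep : ∀ w : List (Fin n), j ∉ w → ∀ v, run f w v j = v j := by
    intro w
    induction w with
    | nil => simp
    | cons i w ih =>
      intro hmem v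
      rw [List.mem_cons, not_or] at hmem
      rw [run_cons, Function.comp_apply, ih hmem.2, instruction,
        Function.update_of_ne hmem.1]
  have := hkeep w hjw fun _ => a
  rw [hw] at this
  simp only [Function.update_self, Equiv.swap_apply_left] at this
  exact hab this.symm

/-- The vector `v` in the first `n` registers and the content of `c` in the others. -/
def fill {A : Type*} {n m : ℕ} (c : Fin m → A) (v : Fin n → A) : Fin m → A :=
  fun j => if h : (j : ℕ) < n then v ⟨j, h⟩ else c j

theorem proj_fill {A : Type*} {n m : ℕ} (hnm : n ≤ m) (c : Fin m → A) (v : Fin n → A) :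
    proj hnm (fill c v) = v := by
  ext i
  simp [proj, fill]

theorem instruction_fill {A : Type*} {n m : ℕ} (hnm : n ≤ m) (f : Tran A m) (c : Fin m → A)
    (v : Fin n → A) (j : Fin n) :
    instruction f (Fin.castLE hnm j) (fill c v) =
      fill c (instruction (fun v => proj hnm (f (fill c v))) j v) := by
  ext i
  by_cases hij : i = Fin.castLE hnm j
  · subst hij
    simp [instruction, fill, proj]
  · have : ∀ h : (i : ℕ) < n, (⟨i, h⟩ : Fin n) ≠ j := by
      rintro h rfl
      exact hij (by ext; simp)
    by_cases h : (i : ℕ) < n <;>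
      simp [instruction, fill, Function.update_of_ne hij, h, Function.update_of_ne (this _)]

theorem proj_instruction_of_le {A : Type*} {n m : ℕ} (hnm : n ≤ m) (f : Tran A m) (j : Fin m)
    (hj : n ≤ j) (s : Fin m → A) : proj hnm (instruction f j s) = proj hnm s := by
  ext i
  have : Fin.castLE hnm i ≠ j := by
    rintro rfl
    have := i.2
    simp at hj
    omega
  simp [proj, instruction, Function.update_of_ne this]

/-- A simulation of all the transformations of `A^n`, in any order, takes at least as many
updates as there are transformations. Successive transformations are different, so each of
them but the first takes an update. If there were no further update, the simulation would start
from the identity and use only instructions of the first `n` registers, one at a time; with the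
other registers frozen, this contradicts `exists_ne_run`. -/
theorem SimulatesVia.le_sum_complexity {A : Type*} [Finite A] [Nontrivial A] {n m : ℕ}
    (hn : 0 < n) {hnm : n ≤ m} {f : Tran A m} {l : ℕ} {g : Fin l → Tran A n}
    {h : Fin l → Tran A m} (hg : Function.Bijective g) (hsim : SimulatesVia hnm f g h) :
    l ≤ ∑ i, complexity f (h i) := by
  obtain _ | l := l
  · simp
  obtain ⟨hmem, hproj⟩ := hsim
  choose w hlen hw using fun i => exists_run_eq_of_length_eq_complexity (hmem i)
  -- the configuration after the first `i` transformations have been simulated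
  let σ : ℕ → Tran A m := fun i => composite ((List.ofFn h).take i)
  have hσ : ∀ i (hi : i < l + 1), σ (i + 1) = h ⟨i, hi⟩ ∘ σ i := composite_take_succ h
  have hσg : ∀ i (hi : i < l + 1) s, proj hnm (σ (i + 1) s) = g ⟨i, hi⟩ (proj hnm s) :=
    fun i hi => hproj ⟨i, hi⟩
  obtain ⟨a⟩ := (inferInstance : Nonempty A)
  let c : Fin m → A := fun _ => a
  have hchange : ∀ i (hi : i + 1 < l + 1),
      ¬ ∀ s, proj hnm (h ⟨i + 1, hi⟩ s) = proj hnm s := by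
    intro i hi hs
    have : g ⟨i + 1, hi⟩ = g ⟨i, by omega⟩ := by
      ext1 v
      have h1 := hσg (i + 1) hi (fill c v)
      have h2 := hσg i (by omega) (fill c v)
      rw [proj_fill] at h1 h2
      rw [← h1, ← h2, hσ (i + 1) hi, Function.comp_apply, hs]
    have := congrArg Fin.val (hg.1 this)
    simp at this
  have hpos : ∀ i : Fin l, 1 ≤ complexity f (h i.succ) := by
    intro i
    by_contra! h0
    have hnil : w i.succ = [] := List.length_eq_zero_iff.1 (by rw [hlen]; omega)
    refine hchange i i.succ.2 fun s => ?_
    have := hw i.succ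
    rw [hnil, run_nil] at this
    change proj hnm (h i.succ s) = _
    rw [← this, id]
  rw [Fin.sum_univ_succ]
  have hsum : l ≤ ∑ i : Fin l, complexity f (h i.succ) := by
    simpa using Finset.sum_le_sum fun i (_ : i ∈ Finset.univ) => hpos i
  by_contra! hlt
  have h0 : complexity f (h 0) = 0 := by omega
  have h1 : ∀ i : Fin l, complexity f (h i.succ) = 1 := by
    have heq : ∑ i : Fin l, 1 = ∑ i : Fin l, complexity f (h i.succ) := by simp; omega
    intro i
    exact ((Finset.sum_eq_sum_iff_of_le fun i _ => hpos i).1 heq i (Finset.mem_univ i)).symm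
  have hid : h 0 = id := by
    have hnil : w 0 = [] := List.length_eq_zero_iff.1 (by rw [hlen, h0])
    have := hw 0
    rw [hnil, run_nil] at this
    exact this.symm
  have hstep : ∀ i (hi : i + 1 < l + 1),
      ∃ j : Fin n, h ⟨i + 1, hi⟩ = instruction f (Fin.castLE hnm j) := by
    intro i hi
    have hone := hlen (Fin.succ ⟨i, by omega⟩)
    rw [h1] at hone
    obtain ⟨j, hj⟩ := List.length_eq_one_iff.1 hone
    have hhj := hw (Fin.succ ⟨i, by omega⟩)
    rw [hj, run_singleton] at hhj
    have hjn : (j : ℕ) < n := by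
      by_contra! hle
      refine hchange i hi fun s => ?_
      change proj hnm (h (Fin.succ ⟨i, by omega⟩) s) = _
      rw [← hhj, proj_instruction_of_le hnm f j hle]
    exact ⟨⟨j, hjn⟩, hhj.symm⟩
  let fc : Tran A n := fun v => proj hnm (f (fill c v))
  have hreach : ∀ i, i < l + 1 → ∃ w, ∀ v, σ (i + 1) (fill c v) = fill c (run fc w v) := by
    intro i
    induction i with
    | zero =>
      intro hi
      refine ⟨[], fun v => ?_⟩
      rw [hσ 0 hi]
      change h 0 _ = _
      rw [hid]
      rfl
    | succ i ih =>
      intro hi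
      obtain ⟨w, hw⟩ := ih (by omega)
      obtain ⟨j, hj⟩ := hstep i hi
      refine ⟨w ++ [j], fun v => ?_⟩
      rw [hσ (i + 1) hi, Function.comp_apply, hw, hj, instruction_fill, run_append]
      rfl
  obtain ⟨g₀, hg₀⟩ := exists_ne_run hn fc
  obtain ⟨i, rfl⟩ := hg.2 g₀
  obtain ⟨w, hw⟩ := hreach i i.2
  refine hg₀ w ?_
  ext1 v
  have := hσg i i.2 (fill c v)
  rw [hw, proj_fill, proj_fill] at this
  exact this

theorem card_tran (A : Type*) [Fintype A] (n : ℕ) :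
    Nat.card (Tran A n) = Fintype.card A ^ (n * Fintype.card A ^ n) := by
  classical
  simp [Tran, pow_mul]

theorem bijective_of_injective_tran {A : Type*} [Fintype A] {n : ℕ}
    {g : Fin (Fintype.card A ^ (n * Fintype.card A ^ n)) → Tran A n}
    (hg : Function.Injective g) : Function.Bijective g :=
  hg.bijective_of_nat_card_le (by rw [card_tran]; simp)

theorem IsCompleteUniversal.le_minSeqTime {A : Type*} [Fintype A] (hA : 2 ≤ Fintype.card A)
    {n m : ℕ} (hn : 0 < n) {hnm : n ≤ m} {f : Tran A m} (hf : IsCompleteUniversal hnm f) :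
    Fintype.card A ^ (n * Fintype.card A ^ n) ≤ minSeqTime hnm f := by
  have : Nontrivial A := Fintype.one_lt_card_iff_nontrivial.1 hA
  have hne : {t : ℕ | ∃ g : Fin (Fintype.card A ^ (n * Fintype.card A ^ n)) → Tran A n,
      Function.Injective g ∧ t = seqTime hnm f g}.Nonempty := by
    have e : Fin (Fintype.card A ^ (n * Fintype.card A ^ n)) ≃ Tran A n :=
      (finCongr (card_tran A n).symm).trans (Finite.equivFin _).symm
    exact ⟨_, e, e.injective, rfl⟩
  obtain ⟨g, hg, hgt⟩ := Nat.sInf_mem hne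
  obtain ⟨h₀, hh₀⟩ := hf _ g
  obtain ⟨h, hh, hht⟩ := Nat.sInf_mem (s := {t : ℕ | ∃ h, SimulatesVia hnm f g h ∧
    t = ∑ i, complexity f (h i)}) ⟨_, h₀, hh₀, rfl⟩
  calc _ ≤ ∑ i, complexity f (h i) := hh.le_sum_complexity hn (bijective_of_injective_tran hg)
    _ = minSeqTime hnm f := (hgt.trans hht).symm

/-! ### Modular Gray codes -/

section Gray

variable {D : Type*}

/-- The modular `q`-ary Gray code on the letters `d₁, …, d_k`, the last letter being the one
used most often: the list of the letters that are to be incremented, one after the other. -/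
def gray (q : ℕ) : List D → List D
  | [] => []
  | d :: ds => (List.replicate (q - 1) (gray q ds ++ [d])).flatten ++ gray q ds

/-- A bound for the total cost of a Gray code whose slow letters `ds` cost at most `C` each.
Adding `C` makes the recursion multiplicative: each slow letter multiplies cost plus `C` by at
most `q`. -/
theorem sum_map_gray_append_le {q : ℕ} (hq : 0 < q) (c : D → ℕ) (C : ℕ) (ds ds₀ : List D)
    (hc : ∀ d ∈ ds, c d ≤ C) :
    ((gray q (ds ++ ds₀)).map c).sum + C ≤ q ^ ds.length * (((gray q ds₀).map c).sum + C) := by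
  induction ds with
  | nil => simp
  | cons d ds ih =>
    have hd := hc d List.mem_cons_self
    have ih := ih fun e he => hc e (List.mem_cons_of_mem _ he)
    obtain ⟨p, rfl⟩ : ∃ p, q = p + 1 := ⟨q - 1, by omega⟩
    simp only [List.cons_append, gray, Nat.add_sub_cancel, List.map_append, List.map_flatten,
      List.map_replicate, List.sum_append, List.sum_flatten, List.sum_replicate, List.map_cons,
      List.map_nil, List.sum_cons, List.sum_nil, add_zero, smul_eq_mul, List.length_cons]
    calc _ ≤ (p + 1) * (((gray (p + 1) (ds ++ ds₀)).map c).sum + C) := by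
          nlinarith [Nat.mul_le_mul_left p hd]
      _ ≤ (p + 1) * ((p + 1) ^ ds.length * (((gray (p + 1) ds₀).map c).sum + C)) :=
          Nat.mul_le_mul_left _ ih
      _ = _ := by ring

theorem length_gray {q : ℕ} (hq : 0 < q) (ds : List D) :
    (gray q ds).length + 1 = q ^ ds.length := by
  induction ds with
  | nil => simp [gray]
  | cons d ds ih =>
    obtain ⟨p, rfl⟩ : ∃ p, q = p + 1 := ⟨q - 1, by omega⟩
    simp only [gray, Nat.add_sub_cancel, List.length_append, List.length_flatten,
      List.map_replicate, List.sum_replicate, List.length_cons, List.length_nil, smul_eq_mul,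
      zero_add, ih]
    rw [add_assoc, ih]
    ring

variable {G : Type*} [AddCommGroup G] (s : D → G)

theorem sum_map_mem_span (ds : List D) (W : List D) (hW : ∀ d ∈ W, d ∈ ds) :
    (W.map s).sum ∈ Submodule.span ℤ (s '' {d | d ∈ ds}) := by
  refine list_sum_mem ?_
  intro x hx
  obtain ⟨d, hd, rfl⟩ := List.mem_map.1 hx
  exact Submodule.subset_span ⟨d, hW d hd, rfl⟩

theorem mem_of_mem_gray {q : ℕ} {ds : List D} : ∀ d ∈ gray q ds, d ∈ ds := by
  induction ds with
  | nil => simp [gray]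
  | cons e ds ih =>
    intro d hd
    simp only [gray, List.mem_append, List.mem_flatten, List.mem_replicate] at hd
    rcases hd with ⟨_, ⟨-, rfl⟩, hd⟩ | hd
    · rcases List.mem_append.1 hd with hd | hd
      · exact List.mem_cons_of_mem _ (ih d hd)
      · simp_all
    · exact List.mem_cons_of_mem _ (ih d hd)

/-- Every element of the subgroup generated by the letters is visited by the Gray code, provided
that `q` times a letter is zero. -/
theorem exists_prefix_gray_sum_eq {q : ℕ} (hq : 0 < q) (hs : ∀ d, q • s d = 0) (ds : List D)
    {x : G} (hx : x ∈ Submodule.span ℤ (s '' {d | d ∈ ds})) :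
    ∃ P, P <+: gray q ds ∧ (P.map s).sum = x := by
  induction ds generalizing x with
  | nil => exact ⟨[], by simp, by simpa [eq_comm] using hx⟩
  | cons d ds ih =>
    have hset : s '' {e | e ∈ d :: ds} = insert (s d) (s '' {e | e ∈ ds}) := by
      rw [← Set.image_insert_eq]
      congr 1
      ext e
      simp
    rw [hset, Submodule.mem_span_insert] at hx
    obtain ⟨a, y, hy, rfl⟩ := hx
    -- only the residue of the coefficient of `d` modulo `q` matters
    obtain ⟨k, hk⟩ : ∃ k : ℕ, (k : ℤ) = a % q :=
      ⟨(a % q).toNat, Int.toNat_of_nonneg (Int.emod_nonneg _ (by omega))⟩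
    have hkq : k < q := by
      have := Int.emod_lt_of_pos a (b := q) (by omega)
      omega
    have hka : a • s d = k • s d := by
      have h1 : a = k + (a / q) * q := by rw [hk]; exact (Int.emod_add_ediv_mul a q).symm
      rw [h1, add_smul, mul_smul, natCast_zsmul, natCast_zsmul, hs, smul_zero, add_zero]
    set W := gray q ds with hWdef
    have hW := sum_map_mem_span s ds W mem_of_mem_gray
    -- every round `W ++ [d]` also shifts by the sum of `W`
    obtain ⟨P, hP, hPs⟩ := ih (x := y - k • (W.map s).sum)
      (Submodule.sub_mem _ hy (Submodule.smul_of_tower_mem _ k hW))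
    refine ⟨(List.replicate k (W ++ [d])).flatten ++ P, ?_, ?_⟩
    · have hrep : List.replicate (q - 1) (W ++ [d]) =
          List.replicate k (W ++ [d]) ++ List.replicate (q - 1 - k) (W ++ [d]) := by
        rw [List.replicate_append_replicate]
        congr 1
        omega
      rw [gray, ← hWdef, hrep, List.flatten_append, List.append_assoc]
      refine (List.prefix_append_right_inj _).2 (hP.trans ?_)
      cases q - 1 - k with
      | zero => simp
      | succ j =>
        rw [List.replicate_succ, List.flatten_cons, List.append_assoc, List.append_assoc]
        exact List.prefix_append _ _
    · simp only [List.map_append, List.map_flatten, List.map_replicate, List.sum_append,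
        List.sum_flatten, List.sum_replicate, List.map_cons, List.map_nil, List.sum_cons,
        List.sum_nil, add_zero, hPs, hka, smul_add]
      abel

end Gray

/-! ### The universal transformation -/

section Network

variable {A : Type*} {n : ℕ}

/-- The register `x_i`, a coordinate of the simulated configuration. -/
def xReg (i : Fin n) : Fin (n + (n + n)) := Fin.castAdd (n + n) i

/-- The register `z_i`. The difference `t_i - z_i` holds the input of the simulation, up to a
known shift. -/
def zReg (i : Fin n) : Fin (n + (n + n)) := Fin.natAdd n (Fin.castAdd n i)

/-- The register `t_i`, the partner of `zReg i`. -/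
def tReg (i : Fin n) : Fin (n + (n + n)) := Fin.natAdd n (Fin.natAdd n i)

@[simp] theorem xReg_inj {i j : Fin n} : xReg i = xReg j ↔ i = j := by
  simp [xReg]

@[simp] theorem zReg_inj {i j : Fin n} : zReg i = zReg j ↔ i = j := by
  simp [zReg]

@[simp] theorem tReg_inj {i j : Fin n} : tReg i = tReg j ↔ i = j := by
  simp [tReg]

@[simp] theorem xReg_ne_zReg (i j : Fin n) : xReg i ≠ zReg j := by
  simp [xReg, zReg, Fin.ext_iff]; omega

@[simp] theorem xReg_ne_tReg (i j : Fin n) : xReg i ≠ tReg j := by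
  simp [xReg, tReg, Fin.ext_iff]; omega

@[simp] theorem zReg_ne_tReg (i j : Fin n) : zReg i ≠ tReg j := by
  simp [zReg, tReg, Fin.ext_iff]; omega

@[simp] theorem zReg_ne_xReg (i j : Fin n) : zReg i ≠ xReg j := (xReg_ne_zReg j i).symm

@[simp] theorem tReg_ne_xReg (i j : Fin n) : tReg i ≠ xReg j := (xReg_ne_tReg j i).symm

@[simp] theorem tReg_ne_zReg (i j : Fin n) : tReg i ≠ zReg j := (zReg_ne_tReg j i).symm

variable [AddCommGroup A]

open Classical in
/-- The universal transformation of `A^(3n)`, for a group `A` with a distinguished element `u`: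
`x_i ← x_i + u` if `t = z` and `x_i ← x_i` otherwise, `z_i ← z_i + u`, and `t_i ← z_i + x_i`. -/
noncomputable def pointerNet (u : A) : Tran A (n + (n + n)) := fun s =>
  Fin.append (fun i => s (xReg i) + if ∀ j, s (tReg j) = s (zReg j) then u else 0)
    (Fin.append (fun i => s (zReg i) + u) (fun i => s (zReg i) + s (xReg i)))

open Classical in
theorem pointerNet_xReg (u : A) (s : Fin (n + (n + n)) → A) (i : Fin n) :
    pointerNet u s (xReg i) =
      s (xReg i) + if ∀ j, s (tReg j) = s (zReg j) then u else 0 := by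
  exact Fin.append_left _ _ i

theorem pointerNet_zReg (u : A) (s : Fin (n + (n + n)) → A) (i : Fin n) :
    pointerNet u s (zReg i) = s (zReg i) + u := by
  exact (Fin.append_right _ _ _).trans (Fin.append_left _ _ i)

theorem pointerNet_tReg (u : A) (s : Fin (n + (n + n)) → A) (i : Fin n) :
    pointerNet u s (tReg i) = s (zReg i) + s (xReg i) := by
  exact (Fin.append_right _ _ _).trans (Fin.append_right _ _ i)

/-- Whatever the initial configuration, with input `v` in the `x`-registers, `σ` leads to a
configuration with `x = g v` and `t - z = v - k`. So `t = z` holds exactly for the input `k`, to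
which the network is said to point. -/
def Tracks (g : Tran A n) (k : Fin n → A) (σ : Tran A (n + (n + n))) : Prop :=
  ∀ s, (∀ i, σ s (xReg i) = g (fun j => s (xReg j)) i) ∧
    ∀ i, σ s (tReg i) = σ s (zReg i) + (s (xReg i) - k i)

theorem Tracks.proj_eq {g : Tran A n} {k : Fin n → A} {σ : Tran A (n + (n + n))}
    (h : Tracks g k σ) (hle : n ≤ n + (n + n)) (s : Fin (n + (n + n)) → A) :
    proj hle (σ s) = g (proj hle s) :=
  funext (h s).1

/-- Updating all the `t`-registers initializes the network. -/
theorem tracks_init (u : A) :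
    Tracks (n := n) id 0 (run (pointerNet u) ((List.finRange n).map tReg)) := by
  have key : ∀ (L : List (Fin n)) (s : Fin (n + (n + n)) → A),
      (∀ i, run (pointerNet u) (L.map tReg) s (xReg i) = s (xReg i)) ∧
      (∀ i, run (pointerNet u) (L.map tReg) s (zReg i) = s (zReg i)) ∧
      ∀ i, (s (tReg i) = s (zReg i) + s (xReg i) ∨ i ∈ L) →
        run (pointerNet u) (L.map tReg) s (tReg i) = s (zReg i) + s (xReg i) := by
    intro L
    induction L with
    | nil => simp
    | cons j L ih =>
      intro s
      have hx : ∀ i, instruction (pointerNet u) (tReg j) s (xReg i) = s (xReg i) := by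
        simp [instruction]
      have hz : ∀ i, instruction (pointerNet u) (tReg j) s (zReg i) = s (zReg i) := by
        simp [instruction]
      obtain ⟨ihx, ihz, iht⟩ := ih (instruction (pointerNet u) (tReg j) s)
      simp only [hx, hz] at ihx ihz iht
      simp only [List.map_cons, run_cons, Function.comp_apply]
      refine ⟨ihx, ihz, fun i hi => iht i ?_⟩
      by_cases hij : i = j
      · subst hij
        left
        simp [instruction, pointerNet_tReg]
      · simpa [instruction, hij] using hi
  intro s
  obtain ⟨hx, hz, ht⟩ := key (List.finRange n) s
  refine ⟨hx, fun i => ?_⟩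
  rw [ht i (Or.inr (List.mem_finRange i)), hz]
  simp

theorem Tracks.zReg_comp {u : A} {g : Tran A n} {k : Fin n → A} {σ : Tran A (n + (n + n))}
    (h : Tracks g k σ) (j : Fin n) :
    Tracks g (k + Pi.single j u) (instruction (pointerNet u) (zReg j) ∘ σ) := by
  intro s
  obtain ⟨hx, ht⟩ := h s
  refine ⟨fun i => by simpa [instruction] using hx i, fun i => ?_⟩
  by_cases hij : i = j
  · subst hij
    simp only [instruction, ne_eq, tReg_ne_zReg, not_false_eq_true, Function.update_of_ne,
      Function.comp_apply, ht, Function.update_self, pointerNet_zReg, Pi.add_apply,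
      Pi.single_eq_same]
    abel
  · simp [instruction, hij, ht]

theorem Tracks.run_zReg_comp {u : A} {g : Tran A n} {k : Fin n → A}
    {σ : Tran A (n + (n + n))} (h : Tracks g k σ) (L : List (Fin n)) :
    Tracks g (k + (L.map fun j => Pi.single j u).sum)
      (run (pointerNet u) (L.map zReg) ∘ σ) := by
  induction L generalizing k σ with
  | nil => simpa using h
  | cons j L ih =>
    have := ih (h.zReg_comp (u := u) j)
    rw [List.map_cons, List.sum_cons, ← add_assoc, List.map_cons, run_cons, Function.comp_assoc]
    exact this

/-- An `x`-instruction changes the simulated transformation at one input only, the one to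
which the network points. -/
theorem Tracks.xReg_comp [DecidableEq A] {u : A} {g : Tran A n} {k : Fin n → A}
    {σ : Tran A (n + (n + n))} (h : Tracks g k σ) (i : Fin n) :
    Tracks (g + Pi.single k (Pi.single i u)) k
      (instruction (pointerNet u) (xReg i) ∘ σ) := by
  intro s
  obtain ⟨hx, ht⟩ := h s
  refine ⟨fun j => ?_, fun j => by simpa [instruction] using ht j⟩
  have hiff : (∀ j, σ s (tReg j) = σ s (zReg j)) ↔ (fun j => s (xReg j)) = k := by
    simp [ht, sub_eq_zero, funext_iff]
  by_cases hij : j = i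
  · subst hij
    by_cases hk : (fun j => s (xReg j)) = k
    · simp [instruction, pointerNet_xReg, hiff, hk, hx]
    · simp [instruction, pointerNet_xReg, hiff, hk, hx]
  · by_cases hk : (fun j => s (xReg j)) = k
    · simp [instruction, hij, hk, hx]
    · simp [instruction, hij, hk, hx]

/-- The pointer can be shifted by any vector `a`, in at most `n q` updates. -/
theorem exists_list_sum_single_eq {u : A} {q : ℕ} (hu : ∀ a : A, ∃ k < q, k • u = a)
    (a : Fin n → A) :
    ∃ L : List (Fin n), (L.map fun j => Pi.single j u).sum = a ∧ L.length + n ≤ n * q := by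
  choose c hc hcu using fun j => hu (a j)
  refine ⟨(List.finRange n).flatMap fun j => List.replicate (c j) j, ?_, ?_⟩
  · rw [List.map_flatMap, List.flatMap_def, List.sum_flatten, List.map_map]
    simp only [Function.comp_def, List.map_replicate, List.sum_replicate]
    rw [← Fin.sum_univ_def]
    ext i
    simp [Finset.sum_apply, Pi.single_apply, hcu]
  · rw [List.length_flatMap]
    simp only [List.length_replicate]
    rw [← Fin.sum_univ_def]
    have : ∑ j, (c j + 1) ≤ ∑ _j : Fin n, q := Finset.sum_le_sum fun j _ => hc j
    simpa [Finset.sum_add_distrib] using this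

/-- The transformation with a single nonzero value: the vector `u e_i` at the input `a`, where
`d = (a, i)`. -/
def unitStep [DecidableEq A] (u : A) (d : (Fin n → A) × Fin n) : Tran A n :=
  Pi.single d.1 (Pi.single d.2 u)

/-- From a network pointing to `0`, one can add `unitStep u d` to the simulated transformation:
the pointer is moved to the input `d.1`, one `x`-register is updated, and the pointer is moved
back. For `d.1 = 0` a single update is enough. -/
theorem exists_program_unitStep [DecidableEq A] {u : A} {q : ℕ}
    (hu : ∀ a : A, ∃ k < q, k • u = a) (d : (Fin n → A) × Fin n) :
    ∃ w : List (Fin (n + (n + n))), w ≠ [] ∧ w.length ≤ (if d.1 = 0 then 1 else 2 * n * q) ∧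
      ∀ g σ, Tracks g 0 σ → Tracks (g + unitStep u d) 0 (run (pointerNet u) w ∘ σ) := by
  obtain ⟨a, i⟩ := d
  by_cases ha : a = 0
  · subst ha
    exact ⟨[xReg i], by simp, by simp, fun g σ h => h.xReg_comp i⟩
  · obtain ⟨L₁, hL₁, hlen₁⟩ := exists_list_sum_single_eq hu a
    obtain ⟨L₂, hL₂, hlen₂⟩ := exists_list_sum_single_eq hu (-a)
    refine ⟨L₁.map zReg ++ xReg i :: L₂.map zReg, by simp, ?_, fun g σ h => ?_⟩
    · have := i.pos
      simp only [ha, if_false, List.length_append, List.length_map, List.length_cons]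
      rw [mul_assoc]
      omega
    · have h₁ := h.run_zReg_comp (u := u) L₁
      rw [hL₁, zero_add] at h₁
      have h₂ := (h₁.xReg_comp (u := u) i).run_zReg_comp (u := u) L₂
      rw [hL₂, add_neg_cancel] at h₂
      rw [run_append, run_cons]
      exact h₂

theorem Tracks.run_flatMap_comp [DecidableEq A] {u : A} {p : (Fin n → A) × Fin n → List (Fin (n + (n + n)))}
    (hp : ∀ d g σ, Tracks g 0 σ → Tracks (g + unitStep u d) 0 (run (pointerNet u) (p d) ∘ σ))
    (P : List ((Fin n → A) × Fin n)) {g : Tran A n} {σ : Tran A (n + (n + n))}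
    (h : Tracks g 0 σ) :
    Tracks (g + (P.map (unitStep u)).sum) 0 (run (pointerNet u) (P.flatMap p) ∘ σ) := by
  induction P generalizing g σ with
  | nil => simpa using h
  | cons d P ih =>
    have := ih (hp d g σ h)
    rw [List.map_cons, List.sum_cons, ← add_assoc, List.flatMap_cons, run_append,
      Function.comp_assoc]
    exact this

theorem nsmul_unitStep_eq_zero [DecidableEq A] {u : A} {q : ℕ} (hqu : q • u = 0) (d : (Fin n → A) × Fin n) :
    q • unitStep u d = 0 := by
  rw [unitStep, ← Pi.single_smul, ← Pi.single_smul, hqu, Pi.single_zero, Pi.single_zero]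

/-- The general form of a simulation by the network: an initialization, followed by programs
that turn each simulated transformation into the next one. -/
theorem simulatesVia_of_tracks {u : A} {hle : n ≤ n + (n + n)} {l : ℕ} {g : Fin l → Tran A n}
    {w : Fin l → List (Fin (n + (n + n)))} (hw : ∀ i, w i ≠ [])
    (h0 : ∀ hl : 0 < l, Tracks (g ⟨0, hl⟩) 0 (run (pointerNet u) (w ⟨0, hl⟩)))
    (hsucc : ∀ i (hi : i + 1 < l) σ, Tracks (g ⟨i, by omega⟩) 0 σ →
      Tracks (g ⟨i + 1, hi⟩) 0 (run (pointerNet u) (w ⟨i + 1, hi⟩) ∘ σ)) :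
    SimulatesVia hle (pointerNet u) g fun i => run (pointerNet u) (w i) := by
  refine ⟨fun i => run_mem_instructionSemigroup _ (hw i), ?_⟩
  have key : ∀ i (hi : i < l), Tracks (g ⟨i, hi⟩) 0
      (composite ((List.ofFn fun i => run (pointerNet u) (w i)).take (i + 1))) := by
    intro i
    induction i with
    | zero =>
      intro hi
      rw [composite_take_succ _ 0 hi]
      exact h0 hi
    | succ i ih =>
      intro hi
      rw [composite_take_succ _ (i + 1) hi]
      exact hsucc i hi _ (ih (by omega))
  exact fun i s => (key i i.2).proj_eq hle s

variable [Fintype A] [DecidableEq A]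

/-- All pairs of an input `a ∈ A^n` and a register `i`, those with `a = 0` last: these are the
ones that the Gray code uses most often. -/
noncomputable def letters (A : Type*) [AddCommGroup A] [Fintype A] [DecidableEq A] (n : ℕ) :
    List ((Fin n → A) × Fin n) :=
  (Finset.univ.filter fun d => d.1 ≠ 0).toList ++ (Finset.univ.filter fun d => d.1 = 0).toList

theorem mem_letters (d : (Fin n → A) × Fin n) : d ∈ letters A n := by
  by_cases hd : d.1 = 0 <;> simp [letters, hd]

theorem length_filter_eq_zero :
    (Finset.univ.filter fun d : (Fin n → A) × Fin n => d.1 = 0).toList.length = n := by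
  rw [Finset.length_toList]
  have : (Finset.univ.filter fun d : (Fin n → A) × Fin n => d.1 = 0) =
      {0} ×ˢ Finset.univ := by
    ext ⟨a, i⟩
    simp [eq_comm]
  rw [this]
  simp

theorem length_letters : (letters A n).length = n * Fintype.card A ^ n := by
  rw [letters, List.length_append, Finset.length_toList, Finset.length_toList, add_comm,
    Finset.card_filter_add_card_filter_not]
  simp [mul_comm]

theorem mem_span_unitStep {u : A} {q : ℕ} (hu : ∀ a : A, ∃ k < q, k • u = a) (g : Tran A n) :
    g ∈ Submodule.span ℤ (unitStep u '' {d | d ∈ letters A n}) := by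
  choose c hc hcu using fun a i => hu (g a i)
  have : g = ∑ a, ∑ i, c a i • unitStep u (a, i) := by
    ext a i
    simp [unitStep, Finset.sum_apply, Pi.single_apply, ite_apply, hcu]
  rw [this]
  exact Submodule.sum_mem _ fun a _ => Submodule.sum_mem _ fun i _ =>
    Submodule.smul_of_tower_mem _ _ (Submodule.subset_span ⟨(a, i), mem_letters _, rfl⟩)

theorem isCompleteUniversal_pointerNet (hn : 0 < n) (hle : n ≤ n + (n + n)) {u : A} {q : ℕ}
    (hq : 0 < q) (hqu : q • u = 0) (hu : ∀ a : A, ∃ k < q, k • u = a) :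
    IsCompleteUniversal hle (pointerNet u) := by
  choose p hp0 _ hp using exists_program_unitStep (n := n) hu
  have hpath : ∀ g g' : Tran A n, ∃ w : List (Fin (n + (n + n))), w ≠ [] ∧
      ∀ σ, Tracks g 0 σ → Tracks g' 0 (run (pointerNet u) w ∘ σ) := by
    intro g g'
    -- one step to make the program nonempty, then a segment of the Gray code
    let d₀ : (Fin n → A) × Fin n := (0, ⟨0, hn⟩)
    obtain ⟨P, -, hP⟩ := exists_prefix_gray_sum_eq (unitStep u) hq (nsmul_unitStep_eq_zero hqu)
      (letters A n) (mem_span_unitStep hu (g' - (g + unitStep u d₀)))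
    refine ⟨p d₀ ++ P.flatMap p, by simp [hp0], fun σ h => ?_⟩
    have := (hp d₀ g σ h).run_flatMap_comp hp P
    rw [hP, add_sub_cancel] at this
    rw [run_append]
    exact this
  choose w hw0 hw using hpath
  intro l g
  refine ⟨_, simulatesVia_of_tracks (w := fun i =>
    if (i : ℕ) = 0 then (List.finRange n).map tReg ++ w id (g i)
    else w (g ⟨i - 1, by omega⟩) (g i)) ?_ ?_ ?_⟩
  · intro i
    by_cases hi : (i : ℕ) = 0 <;> simp [hi, hw0]
  · intro hl
    simp only [if_true, run_append]
    exact hw _ _ _ (tracks_init u)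
  · intro i hi σ h
    simp only [Nat.add_one_ne_zero, if_false, Nat.add_sub_cancel]
    exact hw _ _ _ h

/-- All the transformations of `A^n` can be simulated one after the other in the order of the
Gray code, at the cost of the initialization and of the programs for its letters. -/
theorem exists_surjective_seqTime_pointerNet_le (hn : 0 < n) (hle : n ≤ n + (n + n)) {u : A}
    {q : ℕ} (hq : 0 < q) (hqu : q • u = 0) (hu : ∀ a : A, ∃ k < q, k • u = a) {l : ℕ}
    (hl : l = (gray q (letters A n)).length + 1) :
    ∃ g : Fin l → Tran A n, Function.Surjective g ∧ seqTime hle (pointerNet u) g ≤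
      n + ((gray q (letters A n)).map fun d => if d.1 = 0 then 1 else 2 * n * q).sum := by
  subst hl
  choose p hp0 hplen hp using exists_program_unitStep (n := n) hu
  set W := gray q (letters A n) with hW
  let g : Fin (W.length + 1) → Tran A n := fun i => id + ((W.take i).map (unitStep u)).sum
  let w : Fin (W.length + 1) → List (Fin (n + (n + n))) :=
    Fin.cons ((List.finRange n).map tReg) fun i => p W[i]
  refine ⟨g, fun g' => ?_, ?_⟩
  · obtain ⟨P, hP, hPs⟩ := exists_prefix_gray_sum_eq (unitStep u) hq
      (nsmul_unitStep_eq_zero hqu) (letters A n) (mem_span_unitStep hu (g' - id))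
    refine ⟨⟨P.length, Nat.lt_succ_of_le hP.length_le⟩, ?_⟩
    simp only [g]
    rw [← List.prefix_iff_eq_take.1 hP, hPs, add_sub_cancel]
  · have hsim : SimulatesVia hle (pointerNet u) g fun i => run (pointerNet u) (w i) := by
      refine simulatesVia_of_tracks (fun i => ?_) (fun _ => ?_) fun i hi σ h => ?_
      · refine Fin.cases ?_ (fun i => ?_) i
        · simp [w, hn.ne']
        · simp [w, hp0]
      · simpa [g, w] using tracks_init u
      · have hi' : i < W.length := by omega
        have := hp W[i] _ σ h
        have hg : g ⟨i + 1, hi⟩ = g ⟨i, by omega⟩ + unitStep u W[i] := by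
          simp only [g]
          rw [List.take_succ_eq_append_getElem hi', List.map_append, List.sum_append, add_assoc]
          simp
        rw [hg]
        exact this
    refine hsim.seqTime_le.trans ?_
    calc ∑ i, complexity (pointerNet u) (run (pointerNet u) (w i))
        ≤ ∑ i, (w i).length := Finset.sum_le_sum fun i _ => complexity_run_le _ _
      _ = n + ∑ i : Fin W.length, (p W[i]).length := by simp [Fin.sum_univ_succ, w]
      _ ≤ n + ∑ i : Fin W.length, (if W[i].1 = 0 then 1 else 2 * n * q) :=
          Nat.add_le_add_left (Finset.sum_le_sum fun i _ => hplen _) _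
      _ = _ := by
          congr 1
          exact Fin.sum_univ_fun_getElem W fun d => if d.1 = 0 then 1 else 2 * n * q

theorem minSeqTime_pointerNet_le (hn : 0 < n) (hle : n ≤ n + (n + n)) {u : A}
    (hu : ∀ a : A, ∃ k < Fintype.card A, k • u = a) :
    ∃ k, k + n = n * Fintype.card A ^ n ∧ minSeqTime hle (pointerNet u) ≤
      n + Fintype.card A ^ k * (Fintype.card A ^ n + 2 * n * Fintype.card A) := by
  set q := Fintype.card A with hqdef
  have hq : 0 < q := Fintype.card_pos
  have hqu : q • u = 0 := card_nsmul_eq_zero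
  set ds := (Finset.univ.filter fun d : (Fin n → A) × Fin n => d.1 ≠ 0).toList
  set ds₀ := (Finset.univ.filter fun d : (Fin n → A) × Fin n => d.1 = 0).toList
  have hlen₀ : ds₀.length = n := length_filter_eq_zero
  have hlen : ds.length + n = n * q ^ n := by
    rw [← length_letters (A := A), letters, List.length_append, length_filter_eq_zero]
  obtain ⟨g, hg, hgt⟩ := exists_surjective_seqTime_pointerNet_le hn hle hq hqu hu
    (l := q ^ (n * q ^ n)) (by rw [length_gray hq, length_letters])
  have hinj : Function.Injective g :=
    (hg.bijective_of_nat_card_le (by rw [card_tran]; simp [hqdef])).1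
  refine ⟨ds.length, hlen, (minSeqTime_le_seqTime hinj).trans (hgt.trans ?_)⟩
  refine Nat.add_le_add_left ?_ _
  have hcost := sum_map_gray_append_le hq
    (fun d : (Fin n → A) × Fin n => if d.1 = 0 then 1 else 2 * n * q) (2 * n * q) ds ds₀
    fun d hd => by simp [(Finset.mem_filter.1 (Finset.mem_toList.1 hd)).2]
  have hcost₀ : ((gray q ds₀).map
      fun d : (Fin n → A) × Fin n => if d.1 = 0 then 1 else 2 * n * q).sum + 1 = q ^ n := by
    rw [← congrArg (q ^ ·) hlen₀, ← length_gray hq ds₀, List.map_congr_left (g := fun _ => 1)]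
    · simp
    · intro d hd
      have := Finset.mem_filter.1 (Finset.mem_toList.1 (mem_of_mem_gray d hd))
      simp [this.2]
  refine (Nat.le_add_right _ _).trans (hcost.trans (Nat.mul_le_mul_left _ ?_))
  omega

end Network

end UniversalSimulation

theorem mainTheorem7 :
    (∀ (A : Type*) [Fintype A], 2 ≤ Fintype.card A →
      ∀ (n m : ℕ), 2 ≤ n → ∀ (hnm : n ≤ m) (f : UniversalSimulation.Tran A m),
        UniversalSimulation.IsCompleteUniversal hnm f →
          Fintype.card A ^ (n * Fintype.card A ^ n) ≤ UniversalSimulation.minSeqTime hnm f) ∧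
    (∃ ε : ℕ → ℝ, Filter.Tendsto ε Filter.atTop (nhds 0) ∧
      ∀ (A : Type*) [Fintype A], 2 ≤ Fintype.card A → ∀ n : ℕ, 2 ≤ n →
        ∃ (m : ℕ) (hnm : n ≤ m) (f : UniversalSimulation.Tran A m),
          UniversalSimulation.IsCompleteUniversal hnm f ∧
          ∃ δ : ℝ, |δ| ≤ ε n ∧
            (UniversalSimulation.minSeqTime hnm f : ℝ) =
              (1 + δ) * (Fintype.card A : ℝ) ^ (n * Fintype.card A ^ n)) := by
  refine ⟨fun A _ hA n m hn hnm f hf => hf.le_minSeqTime hA (by omega), ?_⟩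
  refine ⟨fun n => 5 * (n / 2 ^ n), ?_, fun A _ hA n hn => ?_⟩
  · have := (tendsto_pow_const_div_const_pow_of_one_lt 1 (one_lt_two (α := ℝ))).const_mul 5
    simpa using this
  classical
  set q := Fintype.card A with hq
  have : NeZero q := ⟨by omega⟩
  have e : A ≃ ZMod q := Fintype.equivOfCardEq (by rw [ZMod.card])
  let _ : AddCommGroup A := e.addCommGroup
  have hu : ∀ a : A, ∃ k < q, k • e.symm 1 = a := by
    intro a
    refine ⟨(e a).val, ZMod.val_lt _, e.injective ?_⟩
    change e.addEquiv _ = e a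
    rw [map_nsmul]
    change (e a).val • e (e.symm 1) = e a
    simp
  have hle : n ≤ n + (n + n) := by omega
  have hf := UniversalSimulation.isCompleteUniversal_pointerNet (by omega) hle (by omega)
    (card_nsmul_eq_zero (G := A)) hu
  have hlower := hf.le_minSeqTime hA (by omega)
  obtain ⟨k, hk, hupper⟩ := UniversalSimulation.minSeqTime_pointerNet_le (by omega) hle hu
  refine ⟨_, hle, _, hf, ?_⟩
  set T := UniversalSimulation.minSeqTime hle (UniversalSimulation.pointerNet (e.symm 1))
  rw [← hq] at hlower hupper hk
  rw [← hk] at hlower ⊢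
  have hq2 : (2 : ℝ) ≤ q := by exact_mod_cast hA
  have hN : (0 : ℝ) < (q : ℝ) ^ (k + n) := by positivity
  have hlowerR : (q : ℝ) ^ (k + n) ≤ T := by exact_mod_cast hlower
  have hupperR : (T : ℝ) ≤ n + q ^ k * (q ^ n + 2 * n * q) := by exact_mod_cast hupper
  refine ⟨T / q ^ (k + n) - 1, ?_, by field_simp; ring⟩
  rw [abs_of_nonneg (by rw [sub_nonneg, one_le_div hN]; exact hlowerR), sub_le_iff_le_add,
    div_le_iff₀ hN]
  have h2n : (0 : ℝ) < 2 ^ n := by positivity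
  -- the initialization costs `n`, and `2 ^ n ≤ q ^ (k + n)`
  have hinit : (n : ℝ) ≤ n / 2 ^ n * q ^ (k + n) := by
    have h1 : (2 : ℝ) ^ n ≤ q ^ (k + n) :=
      (pow_le_pow_left₀ (by norm_num) hq2 n).trans
        (pow_le_pow_right₀ (by linarith) (by omega))
    rw [div_mul_eq_mul_div, le_div_iff₀ h2n]
    exact mul_le_mul_of_nonneg_left h1 (by positivity)
  -- the pointer moves cost `2 n q` per `q ^ n` transformations, and `2 ^ n q ≤ 2 q ^ n`
  have hmove : (q : ℝ) ^ k * (2 * n * q) ≤ 4 * (n / 2 ^ n) * q ^ (k + n) := by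
    obtain ⟨p, rfl⟩ : ∃ p, n = p + 1 := ⟨n - 1, by omega⟩
    have h1 : (2 : ℝ) ^ p ≤ q ^ p := pow_le_pow_left₀ (by norm_num) hq2 p
    rw [mul_div_assoc', div_mul_eq_mul_div, le_div_iff₀ h2n]
    calc (q : ℝ) ^ k * (2 * (p + 1 : ℕ) * q) * 2 ^ (p + 1)
        = 4 * (p + 1 : ℕ) * (q ^ k * q) * 2 ^ p := by ring
      _ ≤ 4 * (p + 1 : ℕ) * (q ^ k * q) * q ^ p :=
          mul_le_mul_of_nonneg_left h1 (by positivity)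
      _ = _ := by ring
  have hsplit : (q : ℝ) ^ (k + n) = q ^ k * q ^ n := pow_add _ _ _
  nlinarith
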